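/- Let $\mathbb B_3=\langle\sigma_1,\sigma_2\mid\sigma_1\sigma_2\sigma_1=\sigma_2\sigma_1\sigma_2\rangle$, $\Delta=(\sigma_1\sigma_2)^3$, and $\mathbf{PSL}(2,\mathbb Z)=\mathbb B_3/Z(\mathbb B_3)$ with generators $x=\sigma_2^{-1}\sigma_1^{-1}Z(\mathbb B_3)$ and $y=\sigma_1\sigma_2\sigma_1Z(\mathbb B_3)$ (so $x^3=y^2=1$). The Schreier graph of a $\mathbf{PSL}(2,\mathbb Z)$-space has the points as vertices, an $x$-arrow $v\to xv$ and a $y$-edge $\{v,yv\}$ for every point $v$. **Coverings.** Let $\Sigma$ be a finite homogeneous (i.e. transitive) $\mathbb B_3$-space. It is a covering of a $\mathbf{PSL}(2,\mathbb Z)$-space $\overline\Sigma$ if there is a surjective $\mathbb B_3$-equivariant map $\pi:\Sigma\to\overline\Sigma$ such that $\pi(p)=\pi(q)$ implies $p=\Delta^m q$ for some $m\in\mathbb Z$. A $\sigma_i$-cycle is a minimal non-empty subset of $\Sigma$ closed under $\sigma_i$; the covering has simply intersecting cycles if every $\sigma_1$-cycle meets every $\sigma_2$-cycle in at most one point. **Immunity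 and weight.** A quarantine is a non-empty set $Q\subseteq\Sigma$ such that if two of $p,\ \sigma_2p,\ \sigma_1\sigma_2p$ lie in $Q$, so does the third. A plague is a non-empty set $P\subseteq\Sigma$ such that the only quarantine containing $P$ is $\Sigma$, and $imm(\Sigma)$ is the smallest size of a plague divided by $|\Sigma|$. The weight is $\omega(\Sigma)=\frac1{|\Sigma|}\sum_{v\in\Sigma}\omega'_{i(v)j(v)}$, where $i(v)$ and $j(v)$ are the lengths of the $\sigma_1$-cycle and of the $\sigma_2$-cycle of $v$, and $\omega'_{ij}=\omega'_{ji}$ is given by $\omega'_{11}=1$, $\omega'_{2j}=\frac13$ for all $j\ge1$, $\omega'_{13}=\frac{11}{24}$, $\omega'_{1j}=\frac12$ for $j\ge4$, $\omega'_{3j}=\frac7{24}$ for $j\ge3$, and $\omega'_{ij}=\frac14$ for $i,j\ge4$. **The graphs $Span(\mathcal H_k,\mathcal F_1,\mathcal F_2)$.** Let $v_0$ be a vertex with $xv_0=v_0$ and $yv_0\ne v_0$. The subgraph $\mathcal H_0$ consists of $v_0$, its $x$-loop, and its $y$-edge $\{v_0,yv_0\}$; its end vertex is $yv_0$. The subgraph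 $\mathcal H_{j+1}$ arises from $\mathcal H_j$ by choosing an end vertex $w$ of $\mathcal H_j$ such that $xw,\ x^2w,\ yxw,\ yx^2w$ are four distinct vertices outside $\mathcal H_j$, and adding the $x$-triangle at $w$ and the $y$-edges at $xw$ and $x^2w$; the end vertex $w$ is replaced by the two new end vertices $yxw$ and $yx^2w$. So $\mathcal H_k$ has $k$ triangles and $k+1$ end vertices. A copy of the fragment $\mathcal F_1$, or $\mathcal F_2$, with free site $w$ is given by eight distinct vertices, namely $xw$, $x^2w$, $a=yxw$, $b=yx^2w$, $xa$, $x^2a$, $xb$, $x^2b$, such that $$y(xa)=xb,\quad y(x^2a)=x^2b\quad\text{for }\mathcal F_1,\qquad y(xa)=x^2b,\quad y(x^2a)=xb\quad\text{for }\mathcal F_2 .$$ A Schreier graph $\mathcal G$ with distinguished vertex $v_0$ is of the form $Span(\mathcal H_k,\mathcal F_1,\mathcal F_2)$ if it contains some $\mathcal H_k$ as above and arises from it by gluing, at each end vertex of $\mathcal H_k$ without an $x$-loop, a copy of $\mathcal F_1$ or of $\mathcal F_2$ with this vertex as free site; the eight vertices of each copy lie outside $\mathcal H_k$, different copies are disjoint,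 and every vertex of $\mathcal G$ lies in $\mathcal H_k$ or in one of the copies. **Lemma 5.4.** Let $k\ge0$, let $\overline\Sigma$ be a $\mathbf{PSL}(2,\mathbb Z)$-space whose pointed Schreier graph is of the form $\mathcal G=Span(\mathcal H_k,\mathcal F_1,\mathcal F_2)$, and let $\Sigma$ be a finite homogeneous $\mathbb B_3$-space that is a covering of $\overline\Sigma$ with simply intersecting cycles. Then $$imm(\Sigma)\le\omega(\Sigma).$$ -/

import Mathlib

namespace HurwitzOrbit

/-! ### The braid group on three strands and the modular group -/

/-- The braid group on three strands, presented by `σ₁ σ₂ σ₁ = σ₂ σ₁ σ₂`; the generators `0`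
and `1` of the free group stand for `σ₁` and `σ₂`. -/
abbrev B3 : Type :=
  PresentedGroup
    ({FreeGroup.of 0 * FreeGroup.of 1 * FreeGroup.of 0 *
      (FreeGroup.of 1 * FreeGroup.of 0 * FreeGroup.of 1)⁻¹} : Set (FreeGroup (Fin 2)))

/-- The first standard generator. -/
def σ₁ : B3 := PresentedGroup.of 0

/-- The second standard generator. -/
def σ₂ : B3 := PresentedGroup.of 1

/-- The element `(σ₁ σ₂)³`, which generates the center of `B3`. -/
def Δ : B3 := (σ₁ * σ₂) ^ 3

/-- The modular group `PSL(2, ℤ)`, as the quotient of the braid group by its center. -/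
abbrev Modular : Type := B3 ⧸ Subgroup.center B3

/-- The generator `x` of order three of the modular group. -/
def x : Modular := ((σ₂⁻¹ * σ₁⁻¹ : B3) : Modular)

/-- The generator `y` of order two of the modular group. -/
def y : Modular := ((σ₁ * σ₂ * σ₁ : B3) : Modular)

/-! ### Coverings and simply intersecting cycles -/

/-- `π : S → V` is a covering of the `PSL(2, ℤ)`-space `V` by the `B3`-space `S`: it is surjective
and equivariant, and points of the same fiber differ by a power of `Δ`. -/
structure IsCovering {S V : Type*} [MulAction B3 S] [MulAction Modular V] (π : S → V) : Prop where
  surjective : Function.Surjective π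
  equivariant : ∀ (g : B3) (p : S), π (g • p) = (g : Modular) • π p
  fiber : ∀ p q : S, π p = π q → ∃ m : ℤ, p = Δ ^ m • q

/-- A `g`-cycle: a minimal non-empty subset that is closed under the action of `g`. -/
def IsCycle {S : Type*} [MulAction B3 S] (g : B3) (c : Set S) : Prop :=
  Minimal (fun d : Set S => d.Nonempty ∧ ∀ p ∈ d, g • p ∈ d) c

/-- Every `σ₁`-cycle meets every `σ₂`-cycle in at most one point. -/
def SimplyIntersectingCycles (S : Type*) [MulAction B3 S] : Prop :=
  ∀ c₁ c₂ : Set S, IsCycle σ₁ c₁ → IsCycle σ₂ c₂ → (c₁ ∩ c₂).Subsingleton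

/-! ### Immunity -/

/-- A quarantine: a non-empty set that contains all three of `p`, `σ₂ p`, `σ₁ σ₂ p` as soon as it
contains two of them. -/
def IsQuarantine {S : Type*} [MulAction B3 S] (Q : Set S) : Prop :=
  Q.Nonempty ∧ ∀ p : S,
    (p ∈ Q → σ₂ • p ∈ Q → (σ₁ * σ₂) • p ∈ Q) ∧
    (p ∈ Q → (σ₁ * σ₂) • p ∈ Q → σ₂ • p ∈ Q) ∧
    (σ₂ • p ∈ Q → (σ₁ * σ₂) • p ∈ Q → p ∈ Q)

/-- A plague: a non-empty set such that the only quarantine containing it is the whole space. -/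
def IsPlague {S : Type*} [MulAction B3 S] (P : Set S) : Prop :=
  P.Nonempty ∧ ∀ Q : Set S, IsQuarantine Q → P ⊆ Q → Q = Set.univ

/-- The immunity of a finite `B3`-space: the smallest size of a plague divided by the size of the
space. (The whole space is a plague, so the infimum is attained when the space is non-empty.) -/
noncomputable def immunity (S : Type*) [MulAction B3 S] [Fintype S] : ℚ :=
  (sInf {n : ℕ | ∃ P : Set S, IsPlague P ∧ P.ncard = n} : ℕ) / (Fintype.card S : ℚ)

/-! ### Weight -/

/-- The entries `ω'ᵢⱼ`, for `i, j ≥ 1`, of the weight matrix. -/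
def weightMatrix : ℕ → ℕ → ℚ
  | 1, 1 => 1
  | 2, _ => 1 / 3
  | _, 2 => 1 / 3
  | 1, 3 => 11 / 24
  | 3, 1 => 11 / 24
  | 1, _ => 1 / 2
  | _, 1 => 1 / 2
  | 3, _ => 7 / 24
  | _, 3 => 7 / 24
  | _, _ => 1 / 4

/-- The weight of a point that lies on a `σ₁`-cycle of length `i` and a `σ₂`-cycle of length `j`
is `ω'ᵢⱼ`. (In a finite space the length of the `g`-cycle through `p` is the minimal period of `p`
under `g`.) The literature adds a positive correction for some points of three particular
coverings, of quotients with four, six and twelve points respectively; none of these is a covering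
of one of the graphs described by `IsSpan` with simply intersecting cycles. -/
noncomputable def pointWeight {S : Type*} [MulAction B3 S] (p : S) : ℚ :=
  weightMatrix (Function.minimalPeriod (fun q : S => σ₁ • q) p)
    (Function.minimalPeriod (fun q : S => σ₂ • q) p)

/-- The weight of a finite `B3`-space: the average weight of its points. -/
noncomputable def weight (S : Type*) [MulAction B3 S] [Fintype S] : ℚ :=
  (∑ p : S, pointWeight p) / (Fintype.card S : ℚ)

/-! ### The graphs `Span(H_k, F₁, F₂)`

The Schreier graph of a `PSL(2, ℤ)`-space has the points as vertices, an `x`-arrow from `v` to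
`x • v` and a `y`-edge between `v` and `y • v`, for every `v`. -/

section Graphs

variable {V : Type*} [MulAction Modular V]

/-- `RobustChain v₀ k H E`: the set `H` is the vertex set of the last member `H_k` of a sequence
`H₀ ≺₂ H₁ ≺₂ … ≺₂ H_k` of robust subgraphs containing the distinguished vertex `v₀`, and `E` is the
set of its `k + 1` end vertices, which lie on no triangle of `H_k` and are different from `v₀`.
`H₀` is the `x`-loop at `v₀` together with the `y`-edge at `v₀`. A step adds the `x`-triangle at
an end vertex `w` and the `y`-edges at its two other vertices, so one triangle and two `y`-edges,
where these two vertices and their `y`-neighbours are four new vertices (there are no `y`-loops,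
and no `y`-edge joins two vertices of the triangle because `x * y` has no fixed point). -/
inductive RobustChain (v₀ : V) : ℕ → Set V → Set V → Prop
  | base : x • v₀ = v₀ → y • v₀ ≠ v₀ → RobustChain v₀ 0 {v₀, y • v₀} {y • v₀}
  | step {k : ℕ} {H E : Set V} {w : V} : RobustChain v₀ k H E → w ∈ E →
      [x • w, x • x • w, y • x • w, y • x • x • w].Nodup →
      (∀ v ∈ [x • w, x • x • w, y • x • w, y • x • x • w], v ∉ H) →
      RobustChain v₀ (k + 1)
        (H ∪ {x • w, x • x • w, y • x • w, y • x • x • w})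
        ((E \ {w}) ∪ {y • x • w, y • x • x • w})

/-- The vertices, other than `w`, of a copy of `F₁` or `F₂` whose free site is `w`: the two other
vertices `a = x • w`, `b = x • x • w` of the triangle at `w`, and the triangles of `y • a` and
`y • b`. -/
def fragmentVertices (w : V) : List V :=
  [x • w, x • x • w,
    y • x • w, x • y • x • w, x • x • y • x • w,
    y • x • x • w, x • y • x • x • w, x • x • y • x • x • w]

/-- A copy of the fragment `F₁` sits at `w`. With `a' = y • x • w` and `b' = y • x • x • w`, the
remaining two `y`-edges join `x • a'` to `x • b'`, and `x • x • a'` to `x • x • b'`. -/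
def IsFragmentOne (w : V) : Prop :=
  (fragmentVertices w).Nodup ∧
    y • x • y • x • w = x • y • x • x • w ∧
    y • x • x • y • x • w = x • x • y • x • x • w

/-- A copy of the fragment `F₂` sits at `w`. With `a' = y • x • w` and `b' = y • x • x • w`, the
remaining two `y`-edges join `x • a'` to `x • x • b'`, and `x • x • a'` to `x • b'`. -/
def IsFragmentTwo (w : V) : Prop :=
  (fragmentVertices w).Nodup ∧
    y • x • y • x • w = x • x • y • x • x • w ∧
    y • x • x • y • x • w = x • y • x • x • w

/-- The pointed Schreier graph of `V` with distinguished vertex `v₀` is of the form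
`Span(H_k, F₁, F₂)`: it arises from `H_k` by gluing a copy of `F₁` or of `F₂` onto each open
`y`-edge of `H_k`, that is, onto each end vertex of `H_k` without an `x`-loop; the glued copies
are disjoint from `H_k` (but for the free site) and from each other. Further `x`-loops at end
vertices of `H_k` are allowed. -/
def IsSpan (v₀ : V) (k : ℕ) : Prop :=
  ∃ H E : Set V, RobustChain v₀ k H E ∧
    (∀ w ∈ E, x • w ≠ w → IsFragmentOne w ∨ IsFragmentTwo w) ∧
    (∀ w ∈ E, x • w ≠ w → ∀ v ∈ fragmentVertices w, v ∉ H) ∧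
    (∀ w ∈ E, ∀ w' ∈ E, x • w ≠ w → x • w' ≠ w' → w ≠ w' →
      ∀ v ∈ fragmentVertices w, v ∉ fragmentVertices w') ∧
    (∀ v : V, v ∈ H ∨ ∃ w ∈ E, x • w ≠ w ∧ v ∈ fragmentVertices w)

end Graphs

end HurwitzOrbit

/-!
Write `X = σ₂⁻¹σ₁⁻¹` and `Y = σ₁σ₂σ₁`, so that `X³ = Δ⁻¹`, `Y² = Δ`, `σ₂ = YX` and `σ₁ = XY`. A
quarantine is a non-empty set that contains all of `r`, `X • r`, `Y • X • X • r` as soon as it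
contains two of them. The central element `Δ` moves every fiber of `π` in a single cycle, of the
same length `N`. So the points of a fiber are numbered modulo `N`, and the rule becomes a relation
between shifted predicates on `ℤ`. The proof exhibits a plague and compares its size with the weight fiber
by fiber; a vertex contributes at least `N / 4` to the weight.

* The fiber of `v₀` fills that of `y • v₀`, and each triangle of `H_k` costs one more fiber, because
  the four new fibers spread into each other (`IsQuarantine.triangle`). Hence `H_k` can be filled by
  `N / 2` points more than its weight (`RobustChain.exists_fills`), and the task is to save `N / 2`.
* If a new end vertex of a triangle has an `x`-loop, on which `X` acts as `Δ ^ m`, then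
  `3 * m + 1 ≡ 0` modulo `N`. The points over it spread along the progressions `i`, `i + m`,
  `i + 2 * m`, so that two points do instead of `N` (`IsQuarantine.triangle_of_loop`).
* A copy of `F₁` can be filled by `N + 1` points (`IsQuarantine.fragmentOne`). In a copy of `F₂` the
  last four fibers spread by the shift of the `σ₂`-cycle of length two downstairs
  (`IsQuarantine.fragmentTwo`). If that shift is trivial, then the fibers over the triangle at the
  free site spread by the shift of the cycle of length three (`IsQuarantine.fragmentTwo'`). A
  non-trivial shift leaves at most `N / 2` classes. If both shifts are trivial, the fragment costs
  `2 * N`, but its cycles of length two and three lift to cycles of the same length, which raises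
  its weight to `5 / 2 * N`. So each fragment saves `N / 2` (`IsCovering.exists_fill_fragment`).

What remains is `k = 0` with an `x`-loop at `y • v₀`, and `N = 1`. Both contradict the simple
intersection of cycles (`not_both_loops`, `deltaOrder_ne_one`).
-/

namespace HurwitzOrbit

/-! ### The braid group -/

/-- The lift `σ₂⁻¹σ₁⁻¹` to the braid group of the generator `x` of the modular group. -/
def xLift : B3 := σ₂⁻¹ * σ₁⁻¹

/-- The lift `σ₁σ₂σ₁` to the braid group of the generator `y` of the modular group. -/
def yLift : B3 := σ₁ * σ₂ * σ₁

local notation "X" => xLift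
local notation "Y" => yLift

lemma braid_relation : σ₁ * σ₂ * σ₁ = σ₂ * σ₁ * σ₂ := by
  have h : (PresentedGroup.mk ({FreeGroup.of 0 * FreeGroup.of 1 * FreeGroup.of 0 *
      (FreeGroup.of 1 * FreeGroup.of 0 * FreeGroup.of 1)⁻¹} : Set (FreeGroup (Fin 2))))
      (FreeGroup.of 0 * FreeGroup.of 1 * FreeGroup.of 0 *
      (FreeGroup.of 1 * FreeGroup.of 0 * FreeGroup.of 1)⁻¹) = 1 :=
    PresentedGroup.one_of_mem (Set.mem_singleton _)
  rw [map_mul, map_inv, mul_inv_eq_one] at h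
  exact h

lemma yLift_mul_yLift : Y * Y = Δ := by
  have h : Y * Y = (σ₁ * σ₂ * σ₁) * (σ₂ * σ₁ * σ₂) := by rw [← braid_relation]; rfl
  rw [h, Δ]; simp only [pow_succ, pow_zero, one_mul, mul_assoc]

lemma yLift_mul_σ₁ : Y * σ₁ = σ₂ * Y := by
  rw [yLift, braid_relation]; simp only [mul_assoc]
  simp only [← mul_assoc, braid_relation]

lemma yLift_mul_σ₂ : Y * σ₂ = σ₁ * Y := by
  have := braid_relation
  calc Y * σ₂ = σ₁ * (σ₂ * σ₁ * σ₂) := by rw [yLift]; group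
    _ = σ₁ * Y := by rw [← this]; rfl

lemma Δ_mem_center : Δ ∈ Subgroup.center B3 := by
  have h₁ : σ₁ ∈ Subgroup.centralizer {Δ} := by
    rw [Subgroup.mem_centralizer_singleton_iff, ← yLift_mul_yLift, ← mul_assoc, ← yLift_mul_σ₂,
      mul_assoc, ← yLift_mul_σ₁]
    exact (mul_assoc _ _ _).symm
  have h₂ : σ₂ ∈ Subgroup.centralizer {Δ} := by
    rw [Subgroup.mem_centralizer_singleton_iff, ← yLift_mul_yLift, ← mul_assoc, ← yLift_mul_σ₁,
      mul_assoc, ← yLift_mul_σ₂]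
    exact (mul_assoc _ _ _).symm
  have h : (⊤ : Subgroup B3) ≤ Subgroup.centralizer {Δ} := by
    rw [← PresentedGroup.closure_range_of, Subgroup.closure_le]
    rintro _ ⟨i, rfl⟩
    fin_cases i
    · exact h₁
    · exact h₂
  rw [Subgroup.mem_center_iff]
  intro g
  exact (Subgroup.mem_centralizer_singleton_iff.1 (h (Subgroup.mem_top g)))

lemma commute_Δ_zpow (g : B3) (i : ℤ) : g * Δ ^ i = Δ ^ i * g :=
  Subgroup.mem_center_iff.1 (Subgroup.zpow_mem _ Δ_mem_center i) g

lemma yLift_mul_xLift : Y * X = σ₂ := by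
  rw [yLift, braid_relation, xLift]; group

lemma xLift_mul_yLift : X * Y = σ₁ := by
  rw [yLift, braid_relation, xLift]
  have := braid_relation
  calc σ₂⁻¹ * σ₁⁻¹ * (σ₂ * σ₁ * σ₂) = σ₂⁻¹ * σ₁⁻¹ * (σ₁ * σ₂ * σ₁) := by rw [this]
    _ = σ₁ := by group

lemma xLift_pow_three : X * X * X = Δ ^ (-1 : ℤ) := by
  rw [zpow_neg_one, Δ]
  simp only [pow_succ, pow_zero, one_mul, mul_inv_rev, mul_assoc, xLift]

section Action

variable {S : Type*} [MulAction B3 S]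

lemma smul_Δ_zpow (g : B3) (i : ℤ) (p : S) : g • Δ ^ i • p = Δ ^ i • g • p := by
  rw [smul_smul, smul_smul, commute_Δ_zpow]

lemma xLift_smul_Δ_zpow (i : ℤ) (p : S) : X • Δ ^ i • p = Δ ^ i • X • p := smul_Δ_zpow X i p

lemma yLift_smul_Δ_zpow (i : ℤ) (p : S) : Y • Δ ^ i • p = Δ ^ i • Y • p := smul_Δ_zpow Y i p

lemma Δ_zpow_smul_Δ_zpow (i j : ℤ) (p : S) : Δ ^ i • Δ ^ j • p = Δ ^ (i + j) • p := by
  rw [smul_smul, zpow_add]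

lemma yLift_smul_yLift (p : S) : Y • Y • p = Δ ^ (1 : ℤ) • p := by
  rw [smul_smul, yLift_mul_yLift, zpow_one]

lemma xLift_smul_smul_smul (p : S) : X • X • X • p = Δ ^ (-1 : ℤ) • p := by
  rw [smul_smul, smul_smul, xLift_pow_three]

lemma σ₂_smul (p : S) : σ₂ • p = Y • X • p := by rw [smul_smul, yLift_mul_xLift]

lemma σ₁_smul (p : S) : σ₁ • p = X • Y • p := by rw [smul_smul, xLift_mul_yLift]

/-! ### The order of the central element -/

/-- The order of `Δ` as a permutation of `S`. When `S` is transitive, this is the size of each of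
the orbits of `Δ`. -/
noncomputable def deltaOrder (S : Type*) [MulAction B3 S] : ℕ :=
  orderOf (MulAction.toPermHom B3 S Δ)

lemma deltaOrder_pos [Finite S] : 0 < deltaOrder S := orderOf_pos _

lemma Δ_zpow_smul_of_dvd {i : ℤ} (h : (deltaOrder S : ℤ) ∣ i) (p : S) : Δ ^ i • p = p := by
  have h' := orderOf_dvd_iff_zpow_eq_one.1 h
  rw [← map_zpow] at h'
  exact congrArg (fun f : Equiv.Perm S => f p) h'

lemma Δ_zpow_smul_congr {i j : ℤ} (h : (deltaOrder S : ℤ) ∣ i - j) (p : S) :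
    Δ ^ i • p = Δ ^ j • p := by
  rw [show i = j + (i - j) by ring, ← Δ_zpow_smul_Δ_zpow, Δ_zpow_smul_of_dvd h]

lemma dvd_of_Δ_zpow_smul [MulAction.IsPretransitive B3 S] {i : ℤ} {p : S} (h : Δ ^ i • p = p) :
    (deltaOrder S : ℤ) ∣ i := by
  rw [deltaOrder, orderOf_dvd_iff_zpow_eq_one, ← map_zpow]
  ext q
  obtain ⟨g, rfl⟩ := MulAction.exists_smul_eq B3 p q
  change Δ ^ i • g • p = g • p
  rw [← smul_Δ_zpow, h]

/-- A fixed point of the modular generator `x` lifts to a point on which `xLift` acts like a power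
of `Δ` whose exponent is `-1/3` modulo the order of `Δ`. -/
lemma dvd_of_xLift_smul [MulAction.IsPretransitive B3 S] {m : ℤ} {p : S}
    (h : X • p = Δ ^ m • p) : (deltaOrder S : ℤ) ∣ 3 * m + 1 := by
  apply dvd_of_Δ_zpow_smul (p := p)
  have h₃ := xLift_smul_smul_smul p
  simp only [h, xLift_smul_Δ_zpow, Δ_zpow_smul_Δ_zpow] at h₃
  rw [show 3 * m + 1 = 1 + (m + m + m) by ring, ← Δ_zpow_smul_Δ_zpow, h₃, Δ_zpow_smul_Δ_zpow]
  simp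

/-! ### Periodic predicates on the integers -/

/-- An `N`-periodic predicate that propagates by a shift `δ` has at most `gcd δ N` classes. -/
lemma forall_of_shift {f : ℤ → Prop} {N : ℕ} (hN : 0 < N) (hper : ∀ i b : ℤ, f i → f (i + N * b))
    {δ : ℤ} (hδ : ∀ i, f i → f (i + δ)) (h : ∀ i : ℕ, i < Int.gcd δ N → f i) (i : ℤ) : f i := by
  have hn : ∀ (n : ℕ) (i : ℤ), f i → f (i + δ * n) := by
    intro n
    induction n with
    | zero => intro i hi; simpa using hi
    | succ n ih =>
      intro i hi
      have := hδ _ (ih i hi)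
      rwa [show i + δ * n + δ = i + δ * (n + 1 : ℕ) by push_cast; ring] at this
  have hN' : (0 : ℤ) < N := by exact_mod_cast hN
  have ha : ∀ a b i : ℤ, f i → f (i + δ * a + N * b) := by
    intro a b i hi
    have h₁ := hper _ (δ * (a / N) + b) (hn (a % N).toNat i hi)
    rw [Int.toNat_of_nonneg (Int.emod_nonneg _ hN'.ne')] at h₁
    have h₂ := Int.mul_ediv_add_emod a N
    convert h₁ using 1
    linear_combination (-δ) * h₂
  have hd : (0 : ℤ) < Int.gcd δ N := by
    exact_mod_cast Int.gcd_pos_of_ne_zero_right _ hN'.ne'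
  have h₀ : f (i % Int.gcd δ N) := by
    have h₁ := Int.emod_nonneg i hd.ne'
    have h₂ := Int.emod_lt_of_pos i hd
    have := h (i % Int.gcd δ N).toNat (by omega)
    rwa [Int.toNat_of_nonneg h₁] at this
  have h₃ := ha (Int.gcdA δ N * (i / Int.gcd δ N)) (Int.gcdB δ N * (i / Int.gcd δ N)) _ h₀
  have h₄ := Int.mul_ediv_add_emod i (Int.gcd δ N)
  have h₅ := Int.gcd_eq_gcd_ab δ N
  convert h₃ using 1
  linear_combination (-1 : ℤ) * h₄ + (i / Int.gcd δ N) * h₅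

lemma forall_of_progression {f : ℤ → Prop} {N : ℕ} (hN : 0 < N)
    (hper : ∀ i b : ℤ, f i → f (i + N * b)) {m : ℤ} (hm : (N : ℤ) ∣ 3 * m + 1)
    (h : ∀ i, f i → f (i + m) → f (i + 2 * m)) (h₀ : f 0) (h₁ : f m) (i : ℤ) : f i := by
  have hn : ∀ n : ℕ, f (n * m) ∧ f ((n + 1) * m) := by
    intro n
    induction n with
    | zero => simpa using ⟨h₀, h₁⟩
    | succ n ih =>
      have h' := h _ ih.1 (by convert ih.2 using 1; ring)
      push_cast
      exact ⟨ih.2, by convert h' using 1; ring⟩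
  have hN' : (0 : ℤ) < N := by exact_mod_cast hN
  obtain ⟨c, hc⟩ := hm
  -- `m` is a unit modulo `N`, with inverse `-3`, so that `i ≡ (-3 * i) * m`.
  have h' := hper _ ((-3 * i) / N * m + i * c) (hn ((-3 * i) % N).toNat).1
  rw [Int.toNat_of_nonneg (Int.emod_nonneg _ hN'.ne')] at h'
  have h₂ := Int.mul_ediv_add_emod (-3 * i) N
  convert h' using 1
  linear_combination (-m) * h₂ + i * hc

lemma two_mul_gcd_le {N : ℕ} (hN : 0 < N) {δ : ℤ} (h : ¬ (N : ℤ) ∣ δ) : 2 * Int.gcd δ N ≤ N := by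
  obtain ⟨c, hc⟩ : Int.gcd δ N ∣ N := by exact_mod_cast Int.gcd_dvd_right δ N
  have h₁ : (Int.gcd δ N : ℤ) ∣ δ := Int.gcd_dvd_left δ N
  rcases Nat.lt_or_ge c 2 with hc2 | hc2
  · exfalso
    interval_cases c
    · omega
    · rw [mul_one] at hc
      exact h (hc ▸ h₁)
  · calc 2 * Int.gcd δ N ≤ c * Int.gcd δ N := Nat.mul_le_mul_right _ hc2
      _ = N := by rw [mul_comm]; exact hc.symm

/-! ### Spreading inside a quarantine -/

lemma IsQuarantine.triple {Q : Set S} (hQ : IsQuarantine Q) (r : S) :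
    (r ∈ Q → X • r ∈ Q → Y • X • X • r ∈ Q) ∧ (r ∈ Q → Y • X • X • r ∈ Q → X • r ∈ Q) ∧
      (X • r ∈ Q → Y • X • X • r ∈ Q → r ∈ Q) := by
  have h := hQ.2 (X • r)
  have h' : (σ₁ * σ₂) • X • r = r := by rw [smul_smul, xLift]; group; simp
  rw [σ₂_smul, h'] at h
  tauto

lemma IsQuarantine.Δ_periodic (Q : Set S) (q : S) (i b : ℤ) (h : Δ ^ i • q ∈ Q) :
    Δ ^ (i + deltaOrder S * b) • q ∈ Q := by
  rwa [Δ_zpow_smul_congr (j := i) (by simp)]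

/-- The fibers over a triangle, in a quarantine that contains the fibers at the two ends of the
`y`-edge of one of its vertices: the four remaining fibers spread into each other. -/
lemma IsQuarantine.triangle {Q : Set S} (hQ : IsQuarantine Q) {p : S}
    (h : ∀ i : ℤ, Δ ^ i • p ∈ Q) (h' : ∀ i : ℤ, Δ ^ i • Y • p ∈ Q) (i : ℤ) :
    (Δ ^ i • X • X • p ∈ Q ↔ Δ ^ i • X • p ∈ Q) ∧
      (Δ ^ i • Y • X • p ∈ Q ↔ Δ ^ (i + 1) • X • p ∈ Q) ∧
      (Δ ^ i • Y • X • X • p ∈ Q ↔ Δ ^ i • X • p ∈ Q) := by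
  have h₁ : ∀ j : ℤ, Δ ^ j • X • X • p ∈ Q ↔ Δ ^ j • X • p ∈ Q := by
    intro j
    have t := hQ.triple (Δ ^ j • X • p)
    simp only [xLift_smul_Δ_zpow, yLift_smul_Δ_zpow, xLift_smul_smul_smul, Δ_zpow_smul_Δ_zpow] at t
    have := h' (j + -1)
    tauto
  have h₂ : Δ ^ i • Y • X • p ∈ Q ↔ Δ ^ (i + 1) • X • X • p ∈ Q := by
    have t := hQ.triple (Δ ^ (i + 1) • X • X • p)
    simp only [xLift_smul_Δ_zpow, yLift_smul_Δ_zpow, xLift_smul_smul_smul, Δ_zpow_smul_Δ_zpow] at t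
    rw [show i + 1 + -1 = i by ring] at t
    have := h i
    tauto
  have h₃ : Δ ^ i • Y • X • X • p ∈ Q ↔ Δ ^ i • X • p ∈ Q := by
    have t := hQ.triple (Δ ^ i • p)
    simp only [xLift_smul_Δ_zpow, yLift_smul_Δ_zpow] at t
    have := h i
    tauto
  exact ⟨h₁ i, h₂.trans (h₁ _), h₃⟩

/-- Two points over an `x`-loop at an outer vertex of a triangle suffice to fill the four new
fibers of that triangle, and one point does if `Δ` has order two. The reason is that the points
over the loop spread along arithmetic progressions. -/
lemma IsQuarantine.triangle_of_loop [Finite S] [MulAction.IsPretransitive B3 S]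
    {Q : Set S} (hQ : IsQuarantine Q) {p e : S}
    (h : ∀ i : ℤ, Δ ^ i • p ∈ Q) (h' : ∀ i : ℤ, Δ ^ i • Y • p ∈ Q)
    (he : e = Y • X • p ∨ e = Y • X • X • p) {m : ℤ} (hm : X • e = Δ ^ m • e)
    (h₀ : e ∈ Q) (h₁ : deltaOrder S = 2 ∨ Δ ^ m • e ∈ Q) (i : ℤ) : Δ ^ i • X • p ∈ Q := by
  have hd := dvd_of_xLift_smul hm
  have hper := fun i b => IsQuarantine.Δ_periodic Q e i b
  have t := fun i => hQ.triangle h h' i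
  have key : ∀ i : ℤ, (Δ ^ i • e ∈ Q → Δ ^ (i + m) • e ∈ Q → Δ ^ (i + 2 * m) • e ∈ Q) ∧
      (Δ ^ i • e ∈ Q → Δ ^ (i + 2 * m) • e ∈ Q → Δ ^ (i + m) • e ∈ Q) := by
    intro i
    rcases he with rfl | rfl
    · have r := hQ.triple (Δ ^ i • Y • X • p)
      simp only [xLift_smul_Δ_zpow, yLift_smul_Δ_zpow, hm, Δ_zpow_smul_Δ_zpow,
        yLift_smul_yLift] at r
      have t' := (t (i + 2 * m)).2.1
      rw [show i + 2 * m + 1 = i + m + m + 1 by ring] at t'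
      exact ⟨fun a b => t'.2 (r.1 a b), fun a b => r.2.1 a (t'.1 b)⟩
    · have r := hQ.triple (Δ ^ (i + m) • Y • X • X • p)
      simp only [xLift_smul_Δ_zpow, yLift_smul_Δ_zpow, hm, Δ_zpow_smul_Δ_zpow,
        yLift_smul_yLift] at r
      have t' := (t (i + m + m + m + 1)).2.2
      have t'' := (t (i + m + m + m + 1)).1
      -- The exponent `i + 3 * m + 1` agrees with `i` modulo the order of `Δ`.
      have e₁ : Δ ^ (i + m + m + m + 1) • Y • X • X • p = Δ ^ i • Y • X • X • p :=
        Δ_zpow_smul_congr (by convert hd using 1; ring) _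
      rw [e₁] at t'
      rw [show i + m + m = i + 2 * m by ring] at r t' t''
      have t₃ := t'.trans t''.symm
      exact ⟨fun a b => r.2.1 b (t₃.1 a), fun a b => r.2.2 b (t₃.1 a)⟩
  have h₁' : Δ ^ m • e ∈ Q := by
    rcases h₁ with h₁ | h₁
    · have h₂ := hper 0 m (by simpa using h₀)
      rw [h₁] at h₂
      have := (key 0).2 (by simpa using h₀) (by simpa using h₂)
      simpa using this
    · exact h₁
  have all : ∀ i : ℤ, Δ ^ i • e ∈ Q :=
    forall_of_progression (f := fun i => Δ ^ i • e ∈ Q) deltaOrder_pos hper hd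
      (fun i => (key i).1) (by simpa using h₀) h₁'
  rcases he with rfl | rfl
  · have := (t (i - 1)).2.1.1 (all _)
    rwa [sub_add_cancel] at this
  · exact (t i).2.2.1 (all i)

/-- In the fragment `F₁`, one point suffices to fill the last four fibers. -/
lemma IsQuarantine.fragmentOne {Q : Set S} (hQ : IsQuarantine Q) {a b : S}
    (ha : ∀ i : ℤ, Δ ^ i • a ∈ Q) (ha' : ∀ i : ℤ, Δ ^ i • Y • a ∈ Q)
    (hb : ∀ i : ℤ, Δ ^ i • b ∈ Q) (hb' : ∀ i : ℤ, Δ ^ i • Y • b ∈ Q)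
    {α : ℤ} (hα : Y • X • a = Δ ^ α • X • b) (h₀ : X • a ∈ Q) (i : ℤ) :
    Δ ^ i • X • a ∈ Q ∧ Δ ^ i • X • X • a ∈ Q ∧ Δ ^ i • X • b ∈ Q ∧ Δ ^ i • X • X • b ∈ Q := by
  have ta := fun i => hQ.triangle ha ha' i
  have tb := fun i => hQ.triangle hb hb' i
  have hα' : Y • X • b = Δ ^ (1 - α) • X • a := by
    have h := yLift_smul_yLift (X • a)
    rw [hα, smul_Δ_zpow] at h
    rw [sub_eq_neg_add, ← Δ_zpow_smul_Δ_zpow, ← h, Δ_zpow_smul_Δ_zpow]; simp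
  have h₁ : ∀ i : ℤ, Δ ^ i • X • b ∈ Q ↔ Δ ^ (i + 1 - α) • X • a ∈ Q := by
    intro i
    have := (ta (i - α)).2.1
    rw [hα, Δ_zpow_smul_Δ_zpow] at this
    convert this using 4 <;> ring
  have h₂ : ∀ i : ℤ, Δ ^ i • X • b ∈ Q ↔ Δ ^ (i - α) • X • a ∈ Q := by
    intro i
    have := (tb (i - 1)).2.1
    rw [hα', Δ_zpow_smul_Δ_zpow] at this
    convert this.symm using 4 <;> ring
  have h₃ : ∀ i : ℤ, Δ ^ i • X • a ∈ Q ↔ Δ ^ (i + 1) • X • a ∈ Q := by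
    intro i
    have h₄ := (h₁ (i + α)).symm.trans (h₂ (i + α))
    rw [show i + α + 1 - α = i + 1 by ring, show i + α - α = i by ring] at h₄
    exact h₄.symm
  have h₅ : ∀ i : ℤ, Δ ^ i • X • a ∈ Q := by
    intro i
    induction i using Int.induction_on with
    | zero => simpa using h₀
    | succ n ih => exact (h₃ _).1 ih
    | pred n ih => exact (h₃ _).2 (by simpa using ih)
  exact ⟨h₅ i, (ta i).1.2 (h₅ i), (h₂ i).2 (h₅ _), (tb i).1.2 ((h₂ i).2 (h₅ _))⟩

/-- In the fragment `F₂`, the points of the last four fibers spread by the shift `1 + β - α`, which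
belongs to the cycle of length two. -/
lemma IsQuarantine.fragmentTwo [Finite S] {Q : Set S} (hQ : IsQuarantine Q) {a b : S}
    (ha : ∀ i : ℤ, Δ ^ i • a ∈ Q) (ha' : ∀ i : ℤ, Δ ^ i • Y • a ∈ Q)
    (hb : ∀ i : ℤ, Δ ^ i • b ∈ Q) (hb' : ∀ i : ℤ, Δ ^ i • Y • b ∈ Q)
    {α β : ℤ} (hα : Y • X • a = Δ ^ α • X • X • b) (hβ : Y • X • X • a = Δ ^ β • X • b)
    (h₀ : ∀ i : ℕ, i < Int.gcd (1 + β - α) (deltaOrder S) → Δ ^ (i : ℤ) • X • a ∈ Q) (i : ℤ) :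
    Δ ^ i • X • a ∈ Q ∧ Δ ^ i • X • X • a ∈ Q ∧ Δ ^ i • X • b ∈ Q ∧ Δ ^ i • X • X • b ∈ Q := by
  have ta := fun i => hQ.triangle ha ha' i
  have tb := fun i => hQ.triangle hb hb' i
  have h₁ : ∀ i : ℤ, Δ ^ (i + α) • X • b ∈ Q ↔ Δ ^ (i + 1) • X • a ∈ Q := by
    intro i
    have := (ta i).2.1
    rw [hα, Δ_zpow_smul_Δ_zpow] at this
    exact (tb _).1.symm.trans this
  have h₂ : ∀ i : ℤ, Δ ^ (i + β) • X • b ∈ Q ↔ Δ ^ i • X • a ∈ Q := by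
    intro i
    have := (ta i).2.2
    rwa [hβ, Δ_zpow_smul_Δ_zpow] at this
  have h₃ : ∀ i : ℤ, Δ ^ i • X • a ∈ Q → Δ ^ (i + (1 + β - α)) • X • a ∈ Q := by
    intro i hi
    have h₄ := (h₁ (i + β - α)).1 (by rw [sub_add_cancel]; exact (h₂ i).2 hi)
    convert h₄ using 3; ring
  have h₅ : ∀ i : ℤ, Δ ^ i • X • a ∈ Q :=
    forall_of_shift (f := fun i => Δ ^ i • X • a ∈ Q) deltaOrder_pos
      (IsQuarantine.Δ_periodic Q _) h₃ h₀
  have h₆ : ∀ i : ℤ, Δ ^ i • X • b ∈ Q := by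
    intro i
    have := (h₂ (i - β)).2 (h₅ _)
    rwa [sub_add_cancel] at this
  exact ⟨h₅ i, (ta i).1.2 (h₅ i), h₆ i, (tb i).1.2 (h₆ i)⟩

/-- In a copy of the fragment `F₂` at `p` whose cycles of length two lift to cycles of length two,
the fiber of `X • Y • X • p` makes the points `Δ ^ i • X • p` spread by the shift `β - 1`, which
belongs to the cycle of length three. -/
lemma IsQuarantine.fragmentTwo' [Finite S] {Q : Set S} (hQ : IsQuarantine Q) {p : S}
    (h : ∀ i : ℤ, Δ ^ i • p ∈ Q) (h' : ∀ i : ℤ, Δ ^ i • Y • p ∈ Q) {β : ℤ}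
    (hα : Y • X • Y • X • p = Δ ^ (1 + β) • X • X • Y • X • X • p)
    (hβ : Y • X • X • Y • X • p = Δ ^ β • X • Y • X • X • p)
    (h₁ : ∀ i : ℤ, Δ ^ i • X • Y • X • p ∈ Q)
    (h₀ : ∀ i : ℕ, i < Int.gcd (β - 1) (deltaOrder S) → Δ ^ (i : ℤ) • X • p ∈ Q) (i : ℤ) :
    Δ ^ i • X • p ∈ Q := by
  refine forall_of_shift (f := fun i => Δ ^ i • X • p ∈ Q) deltaOrder_pos
    (IsQuarantine.Δ_periodic Q _) ?_ h₀ i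
  intro i hi
  have t := fun i => hQ.triangle h h' i
  -- Two triples over the triangle of `y • x • π p`.
  have r₁ := hQ.triple (Δ ^ i • X • Y • X • p)
  simp only [xLift_smul_Δ_zpow, yLift_smul_Δ_zpow, xLift_smul_smul_smul,
    yLift_smul_yLift, Δ_zpow_smul_Δ_zpow] at r₁
  rw [show i + -1 + 1 = i by ring] at r₁
  have s₁ : Δ ^ i • X • X • Y • X • p ∈ Q := r₁.2.1 (h₁ i) hi
  have r₂ := hQ.triple (Δ ^ i • X • X • Y • X • p)
  simp only [xLift_smul_Δ_zpow, yLift_smul_Δ_zpow, xLift_smul_smul_smul,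
    hα, Δ_zpow_smul_Δ_zpow] at r₂
  have s₂ := r₂.1 s₁ ((t _).2.1.2 (by rwa [neg_add_cancel_right]))
  -- A triple over the triangle of `y • x • x • π p` contains the last two of these points, but with
  -- a point over `x • π p` of another index.
  have hβ' : Y • X • Y • X • X • p = Δ ^ (1 - β) • X • X • Y • X • p := by
    have e := yLift_smul_yLift (X • X • Y • X • p)
    rw [hβ, smul_Δ_zpow] at e
    rw [sub_eq_neg_add, ← Δ_zpow_smul_Δ_zpow, ← e, Δ_zpow_smul_Δ_zpow]; simp
  have r₃ := hQ.triple (Δ ^ (i + β) • X • X • Y • X • X • p)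
  simp only [xLift_smul_Δ_zpow, yLift_smul_Δ_zpow, xLift_smul_smul_smul,
    hβ', Δ_zpow_smul_Δ_zpow] at r₃
  rw [show i + -1 + (1 + β) = i + β by ring] at s₂
  rw [show i + β + -1 + (1 - β) = i by ring] at r₃
  have := (t _).2.2.1 (r₃.2.1 s₂ s₁)
  convert this using 3; ring

end Action

/-! ### Simply intersecting cycles -/

section Cycles

variable {S : Type*} [MulAction B3 S]

lemma isCycle_range_zpow [Finite S] (g : B3) (p : S) :
    IsCycle g (Set.range fun n : ℤ => g ^ n • p) := by
  refine ⟨⟨⟨p, 0, by simp⟩, ?_⟩, ?_⟩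
  · rintro _ ⟨n, rfl⟩
    exact ⟨1 + n, by simp only [zpow_add, zpow_one, mul_smul]⟩
  · rintro d ⟨⟨q, hq⟩, hd⟩ hdc _ ⟨b, rfl⟩
    obtain ⟨a, rfl⟩ := hdc hq
    have hpow : ∀ n : ℕ, g ^ (n : ℤ) • g ^ a • p ∈ d := by
      intro n
      induction n with
      | zero => simpa using hq
      | succ n ih =>
        have := hd _ ih
        rwa [smul_smul g, ← zpow_one_add, add_comm (1 : ℤ)] at this
    have hM : 0 < orderOf (MulAction.toPermHom B3 S g) := orderOf_pos _
    set M := orderOf (MulAction.toPermHom B3 S g)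
    have h := hpow ((b - a) % M).toNat
    rw [Int.toNat_of_nonneg (Int.emod_nonneg _ (by omega))] at h
    convert h using 1
    have e : MulAction.toPermHom B3 S g ^ ((b - a) % M) = MulAction.toPermHom B3 S g ^ (b - a) :=
      zpow_mod_orderOf _ _
    rw [← map_zpow, ← map_zpow] at e
    have e' := congrArg (fun f : Equiv.Perm S => f (g ^ a • p)) e
    change g ^ ((b - a) % M) • g ^ a • p = g ^ (b - a) • g ^ a • p at e'
    rw [e', smul_smul, ← zpow_add, sub_add_cancel]

lemma SimplyIntersectingCycles.eq [Finite S] (hS : SimplyIntersectingCycles S) {p q : S} {i j : ℤ}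
    (h₁ : q = σ₁ ^ i • p) (h₂ : q = σ₂ ^ j • p) : q = p :=
  hS _ _ (isCycle_range_zpow σ₁ p) (isCycle_range_zpow σ₂ p) ⟨⟨i, h₁.symm⟩, ⟨j, h₂.symm⟩⟩
    ⟨⟨0, by simp⟩, ⟨0, by simp⟩⟩

/-- If `Δ` acted trivially, then the two cycles through a point `p` over an `x`-loop would both
contain `yLift • p`. -/
lemma deltaOrder_ne_one [Finite S] (hS : SimplyIntersectingCycles S) {m : ℤ} {p : S}
    (hp : X • p = Δ ^ m • p) (hy : Y • p ≠ p) : deltaOrder S ≠ 1 := by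
  intro h
  have hΔ : ∀ (i : ℤ) (q : S), Δ ^ i • q = q := fun i q => Δ_zpow_smul_of_dvd (by simp [h]) q
  rw [hΔ] at hp
  refine hy (hS.eq (i := -1) (j := 1) ?_ ?_)
  · rw [zpow_neg_one, eq_inv_smul_iff, σ₁_smul, yLift_smul_yLift, hΔ, hp]
  · rw [zpow_one, σ₂_smul, hp]

/-- The two ends of a `y`-edge are not both `x`-loops: otherwise `σ₁²` and `σ₂²` would act on a
point over this edge by the same power of `Δ`, whose triviality would force `Δ` to act trivially. -/
lemma not_both_loops [Finite S] [MulAction.IsPretransitive B3 S] (hS : SimplyIntersectingCycles S)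
    {m n : ℤ} {p : S} (hp : X • p = Δ ^ m • p) (hq : X • Y • p = Δ ^ n • Y • p)
    (hy : Y • p ≠ p) : False := by
  apply deltaOrder_ne_one hS hp hy
  have h₁ := dvd_of_xLift_smul hp
  have h₂ := dvd_of_xLift_smul hq
  have h₃ : Δ ^ (m + n + 1) • p = p := by
    refine hS.eq (i := 2) (j := 2) ?_ ?_
    · rw [zpow_two, mul_smul, σ₁_smul p, hq, σ₁_smul]
      simp only [xLift_smul_Δ_zpow, yLift_smul_Δ_zpow, yLift_smul_yLift, hp, Δ_zpow_smul_Δ_zpow]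
      rw [add_comm m n, add_right_comm]
    · rw [zpow_two, mul_smul, σ₂_smul p, hp, σ₂_smul]
      simp only [xLift_smul_Δ_zpow, yLift_smul_Δ_zpow, hq, yLift_smul_yLift, Δ_zpow_smul_Δ_zpow]
  have h₄ := dvd_of_Δ_zpow_smul h₃
  have h₅ : (deltaOrder S : ℤ) ∣ 1 := by
    have := (dvd_mul_of_dvd_right h₄ 3).sub (h₁.add h₂)
    rwa [show 3 * (m + n + 1) - (3 * m + 1 + (3 * n + 1)) = 1 by ring] at this
  exact_mod_cast Int.eq_one_of_dvd_one (by positivity) h₅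

end Cycles

/-! ### Weights -/

lemma one_fourth_le_weightMatrix (i j : ℕ) : 1 / 4 ≤ weightMatrix i j := by
  unfold weightMatrix
  split <;> norm_num

lemma weightMatrix_two_left (j : ℕ) : weightMatrix 2 j = 1 / 3 := by
  unfold weightMatrix
  split <;> simp_all

lemma weightMatrix_two_right (i : ℕ) : weightMatrix i 2 = 1 / 3 := by
  unfold weightMatrix
  split <;> simp_all

lemma le_weightMatrix_three_left (j : ℕ) : 7 / 24 ≤ weightMatrix 3 j := by
  unfold weightMatrix
  split <;> simp_all <;> norm_num

lemma le_weightMatrix_three_right (i : ℕ) : 7 / 24 ≤ weightMatrix i 3 := by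
  unfold weightMatrix
  split <;> simp_all <;> norm_num

section Weight

variable {S : Type*} [MulAction B3 S]

lemma minimalPeriod_smul_eq_prime (g : B3) {n : ℕ} [Fact n.Prime] {p : S} (h : g ^ n • p = p)
    (h' : g • p ≠ p) : Function.minimalPeriod (fun q : S => g • q) p = n := by
  refine Function.minimalPeriod_eq_prime ?_ h'
  change (fun q : S => g • q)^[n] p = p
  rw [smul_iterate]
  exact h

lemma minimalPeriod_σ₁_yLift (p : S) :
    Function.minimalPeriod (fun q : S => σ₁ • q) (Y • p) =
      Function.minimalPeriod (fun q : S => σ₂ • q) p := by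
  refine Function.minimalPeriod_eq_minimalPeriod_iff.2 fun n => ?_
  have h : ∀ n : ℕ, σ₁ ^ n • Y • p = Y • σ₂ ^ n • p := by
    intro n
    induction n with
    | zero => simp
    | succ n ih =>
      rw [pow_succ', mul_smul, ih, pow_succ', mul_smul, smul_smul, ← yLift_mul_σ₂, mul_smul]
  rw [Function.IsPeriodicPt, Function.IsFixedPt, smul_iterate, Function.IsPeriodicPt,
    Function.IsFixedPt, smul_iterate]
  simp only [h, smul_left_cancel_iff]

lemma one_fourth_le_pointWeight (p : S) : 1 / 4 ≤ pointWeight p := one_fourth_le_weightMatrix _ _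

end Weight

/-! ### Fibers of a covering -/

open scoped Classical in
/-- The total weight of the points over the vertices in `U`. -/
noncomputable def weightOver {S V : Type*} [MulAction B3 S] [Fintype S] (π : S → V) (U : Set V) :
    ℚ :=
  ∑ p : S with π p ∈ U, pointWeight p

section WeightOver

variable {S V : Type*} [MulAction B3 S] [Fintype S] {π : S → V}

lemma weightOver_union {U U' : Set V} (h : Disjoint U U') :
    weightOver π (U ∪ U') = weightOver π U + weightOver π U' := by
  classical
  unfold weightOver
  rw [← Finset.sum_union]
  · congr 1; ext p; simp
  · rw [Finset.disjoint_filter]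
    exact fun p _ h₁ h₂ => Set.disjoint_left.1 h h₁ h₂

lemma weightOver_list {l : List V} (hl : l.Nodup) :
    weightOver π {v | v ∈ l} = (l.map fun v => weightOver π {v}).sum := by
  induction l with
  | nil => simp [weightOver]
  | cons a l ih =>
    rw [List.nodup_cons] at hl
    rw [List.map_cons, List.sum_cons, ← ih hl.2, ← weightOver_union]
    · congr 1; ext v; simp
    · simpa using hl.1

end WeightOver

section Covering

open scoped Classical in
/-- The points `q`, `Δ • q`, …, `Δ ^ (n - 1) • q`. -/
noncomputable def deltaSegment {S : Type*} [MulAction B3 S] (q : S) (n : ℕ) : Finset S :=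
  (Finset.range n).image fun i : ℕ => Δ ^ (i : ℤ) • q

variable {S V : Type*} [MulAction B3 S] [MulAction Modular V] {π : S → V}

lemma card_deltaSegment_le (q : S) (n : ℕ) : (deltaSegment q n).card ≤ n := by
  classical
  unfold deltaSegment
  exact Finset.card_image_le.trans (Finset.card_range n).le

lemma deltaSegment_subset {q : S} {n : ℕ} {Q : Set S} :
    (deltaSegment q n : Set S) ⊆ Q ↔ ∀ i : ℕ, i < n → Δ ^ (i : ℤ) • q ∈ Q := by
  simp [deltaSegment, Set.subset_def]

lemma forall_zpow_of_deltaSegment [Finite S] {q : S} {Q : Set S}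
    (h : (deltaSegment q (deltaOrder S) : Set S) ⊆ Q) (i : ℤ) : Δ ^ i • q ∈ Q :=
  forall_of_shift (f := fun i => Δ ^ i • q ∈ Q) deltaOrder_pos (IsQuarantine.Δ_periodic Q q)
    (δ := 0) (by simp) (by simpa using deltaSegment_subset.1 h) i

namespace IsCovering

lemma map_xLift (hπ : IsCovering π) (p : S) : π (X • p) = x • π p := hπ.equivariant X p

lemma map_yLift (hπ : IsCovering π) (p : S) : π (Y • p) = y • π p := hπ.equivariant Y p

lemma map_Δ_zpow (hπ : IsCovering π) (i : ℤ) (p : S) : π (Δ ^ i • p) = π p := by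
  rw [hπ.equivariant, (QuotientGroup.eq_one_iff _).2 (Subgroup.zpow_mem _ Δ_mem_center i),
    one_smul]

lemma y_smul_y_smul (hπ : IsCovering π) (v : V) : y • y • v = v := by
  obtain ⟨p, rfl⟩ := hπ.surjective v
  rw [← hπ.map_yLift, ← hπ.map_yLift, yLift_smul_yLift, hπ.map_Δ_zpow]

lemma forall_fiber_iff (hπ : IsCovering π) {Q : Set S} (p : S) :
    (∀ q, π q = π p → q ∈ Q) ↔ ∀ i : ℤ, Δ ^ i • p ∈ Q := by
  refine ⟨fun h i => h _ (hπ.map_Δ_zpow i p), fun h q hq => ?_⟩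
  obtain ⟨m, rfl⟩ := hπ.fiber q p hq
  exact h m

variable [Fintype S]

lemma deltaOrder_mul_le [MulAction.IsPretransitive B3 S] (hπ : IsCovering π) {c : ℚ} (p : S)
    (h : ∀ i : ℤ, c ≤ pointWeight (Δ ^ i • p)) : deltaOrder S * c ≤ weightOver π {π p} := by
  classical
  have hle : deltaOrder S • c ≤ ∑ q ∈ deltaSegment p (deltaOrder S), pointWeight q := by
    have hcard : (deltaSegment p (deltaOrder S)).card = deltaOrder S := by
      rw [deltaSegment, Finset.card_image_of_injOn, Finset.card_range]
      intro i hi j hj hij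
      have hij' : Δ ^ (i : ℤ) • p = Δ ^ (j : ℤ) • p := hij
      have h₁ : Δ ^ ((i : ℤ) - j) • p = p := by
        rw [sub_eq_neg_add, ← Δ_zpow_smul_Δ_zpow, hij', Δ_zpow_smul_Δ_zpow]; simp
      have h₂ := dvd_of_Δ_zpow_smul h₁
      have h₃ := Int.eq_zero_of_abs_lt_dvd h₂ (by
        simp only [Finset.coe_range, Set.mem_Iio] at hi hj
        rw [abs_lt]; omega)
      omega
    nth_rewrite 1 [← hcard]
    apply Finset.card_nsmul_le_sum
    intro q hq
    obtain ⟨i, -, rfl⟩ := Finset.mem_image.1 hq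
    exact h i
  rw [← nsmul_eq_mul]
  refine hle.trans (Finset.sum_le_sum_of_subset_of_nonneg ?_ fun q _ _ =>
    (by norm_num : (0 : ℚ) ≤ 1 / 4).trans (one_fourth_le_pointWeight q))
  intro q hq
  obtain ⟨i, -, rfl⟩ := Finset.mem_image.1 hq
  simpa using hπ.map_Δ_zpow i p

lemma weightOver_singleton_ge [MulAction.IsPretransitive B3 S] (hπ : IsCovering π) (v : V) :
    deltaOrder S * (1 / 4 : ℚ) ≤ weightOver π {v} := by
  obtain ⟨p, rfl⟩ := hπ.surjective v
  exact hπ.deltaOrder_mul_le p fun i => one_fourth_le_pointWeight _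

end IsCovering

end Covering

/-! ### The cost of a fragment -/

section Fragments

variable {S V : Type*} [MulAction B3 S] [MulAction Modular V] {π : S → V}

/-- Once the points over `p` and over `X • p` are in a quarantine, so are all points over the
triangle and over the `y`-edges at its vertices. -/
lemma IsQuarantine.triangle_full {Q : Set S} (hQ : IsQuarantine Q) {p : S}
    (h : ∀ i : ℤ, Δ ^ i • p ∈ Q) (h' : ∀ i : ℤ, Δ ^ i • Y • p ∈ Q)
    (hu : ∀ i : ℤ, Δ ^ i • X • p ∈ Q) :
    (∀ i : ℤ, Δ ^ i • X • X • p ∈ Q) ∧ (∀ i : ℤ, Δ ^ i • Y • X • p ∈ Q) ∧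
      (∀ i : ℤ, Δ ^ i • Y • X • X • p ∈ Q) ∧ (∀ i : ℤ, Δ ^ i • Y • Y • X • p ∈ Q) ∧
      (∀ i : ℤ, Δ ^ i • Y • Y • X • X • p ∈ Q) := by
  have t := fun i => hQ.triangle h h' i
  have hs : ∀ i : ℤ, Δ ^ i • X • X • p ∈ Q := fun i => (t i).1.2 (hu i)
  refine ⟨hs, fun i => (t i).2.1.2 (hu _), fun i => (t i).2.2.2 (hu i), fun i => ?_, fun i => ?_⟩
  · rw [yLift_smul_yLift, Δ_zpow_smul_Δ_zpow]; exact hu _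
  · rw [yLift_smul_yLift, Δ_zpow_smul_Δ_zpow]; exact hs _

namespace IsCovering

/-- A point on a `σ₂`-cycle of prime length `n` carries this cycle to a `σ₁`-cycle through its
`y`-neighbor, so the weights over both vertices are bounded by those of a cycle of length `n`. -/
lemma weightOver_of_cycle [Fintype S] [MulAction.IsPretransitive B3 S] (hπ : IsCovering π)
    {n : ℕ} [Fact n.Prime] {c : ℚ} (hl : ∀ j, c ≤ weightMatrix n j)
    (hr : ∀ i, c ≤ weightMatrix i n) {q : S} (h : σ₂ ^ n • q = q) (h' : σ₂ • q ≠ q) :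
    deltaOrder S * c ≤ weightOver π {π q} ∧ deltaOrder S * c ≤ weightOver π {π (Y • q)} := by
  have hper : ∀ i : ℤ, Function.minimalPeriod (fun r : S => σ₂ • r) (Δ ^ i • q) = n := fun i =>
    minimalPeriod_smul_eq_prime σ₂ (by rw [smul_Δ_zpow, h])
      (by rw [smul_Δ_zpow]; exact fun e => h' (smul_left_cancel _ e))
  refine ⟨hπ.deltaOrder_mul_le q fun i => ?_, hπ.deltaOrder_mul_le _ fun i => ?_⟩
  · rw [pointWeight, hper]; exact hr _
  · rw [pointWeight, ← yLift_smul_Δ_zpow, minimalPeriod_σ₁_yLift, hper]; exact hl _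

lemma forall_fragmentVertices (hπ : IsCovering π) {Q : Set S} {p : S}
    (h₁ : ∀ i : ℤ, Δ ^ i • X • p ∈ Q) (h₂ : ∀ i : ℤ, Δ ^ i • X • X • p ∈ Q)
    (h₃ : ∀ i : ℤ, Δ ^ i • Y • X • p ∈ Q) (h₄ : ∀ i : ℤ, Δ ^ i • Y • X • X • p ∈ Q)
    (h₅ : ∀ i : ℤ, Δ ^ i • X • Y • X • p ∈ Q ∧ Δ ^ i • X • X • Y • X • p ∈ Q ∧
      Δ ^ i • X • Y • X • X • p ∈ Q ∧ Δ ^ i • X • X • Y • X • X • p ∈ Q)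
    (q : S) (hq : π q ∈ fragmentVertices (π p)) : q ∈ Q := by
  simp only [fragmentVertices, ← hπ.map_xLift, ← hπ.map_yLift, List.mem_cons, List.not_mem_nil,
    or_false] at hq
  rcases hq with hq | hq | hq | hq | hq | hq | hq | hq
  · exact (hπ.forall_fiber_iff _).2 h₁ q hq
  · exact (hπ.forall_fiber_iff _).2 h₂ q hq
  · exact (hπ.forall_fiber_iff _).2 h₃ q hq
  · exact (hπ.forall_fiber_iff _).2 (fun i => (h₅ i).1) q hq
  · exact (hπ.forall_fiber_iff _).2 (fun i => (h₅ i).2.1) q hq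
  · exact (hπ.forall_fiber_iff _).2 h₄ q hq
  · exact (hπ.forall_fiber_iff _).2 (fun i => (h₅ i).2.2.1) q hq
  · exact (hπ.forall_fiber_iff _).2 (fun i => (h₅ i).2.2.2) q hq

lemma weightOver_fragmentVertices_ge [Fintype S] [MulAction.IsPretransitive B3 S]
    (hπ : IsCovering π) {w : V} (hw : (fragmentVertices w).Nodup) :
    2 * (deltaOrder S : ℚ) ≤ weightOver π {v | v ∈ fragmentVertices w} := by
  rw [weightOver_list hw]
  simp only [fragmentVertices, List.map_cons, List.map_nil, List.sum_cons, List.sum_nil]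
  linarith [hπ.weightOver_singleton_ge (x • w), hπ.weightOver_singleton_ge (x • x • w),
    hπ.weightOver_singleton_ge (y • x • w), hπ.weightOver_singleton_ge (x • y • x • w),
    hπ.weightOver_singleton_ge (x • x • y • x • w), hπ.weightOver_singleton_ge (y • x • x • w),
    hπ.weightOver_singleton_ge (x • y • x • x • w),
    hπ.weightOver_singleton_ge (x • x • y • x • x • w)]

/-- If in a copy of `F₂` the cycles of length two and three lift to cycles of the same length, then
these short cycles increase the weight of the fragment by half a fiber. -/
lemma weightOver_fragmentTwo_ge [Fintype S] [MulAction.IsPretransitive B3 S]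
    (hπ : IsCovering π) {p : S} (hw : (fragmentVertices (π p)).Nodup)
    (hα : Y • X • Y • X • p = Δ ^ (2 : ℤ) • X • X • Y • X • X • p)
    (hβ : Y • X • X • Y • X • p = Δ ^ (1 : ℤ) • X • Y • X • X • p) :
    5 / 2 * (deltaOrder S : ℚ) ≤ weightOver π {v | v ∈ fragmentVertices (π p)} := by
  rw [weightOver_list hw]
  simp only [fragmentVertices, ← hπ.map_xLift, ← hπ.map_yLift, List.map_cons, List.map_nil,
    List.sum_cons, List.sum_nil]
  simp only [fragmentVertices, ← hπ.map_xLift, ← hπ.map_yLift, List.nodup_cons, List.mem_cons,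
    List.not_mem_nil, or_false, not_or] at hw
  have hα' : Y • X • X • Y • X • X • p = Δ ^ (-1 : ℤ) • X • Y • X • p := by
    have e := yLift_smul_yLift (X • Y • X • p)
    rw [hα, yLift_smul_Δ_zpow] at e
    rw [show (-1 : ℤ) = -2 + 1 by norm_num, ← Δ_zpow_smul_Δ_zpow, ← e, Δ_zpow_smul_Δ_zpow]; simp
  have hβ' : Y • X • Y • X • X • p = X • X • Y • X • p := by
    have e := yLift_smul_yLift (X • X • Y • X • p)
    rw [hβ, yLift_smul_Δ_zpow] at e
    exact smul_left_cancel _ e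
  have e₁ : σ₂ • X • Y • X • p = Δ ^ (1 : ℤ) • X • Y • X • X • p := by rw [σ₂_smul, hβ]
  have e₂ : σ₂ • X • Y • X • X • p = Δ ^ (-1 : ℤ) • X • Y • X • p := by rw [σ₂_smul, hα']
  have e₃ : σ₂ • X • p = Y • X • X • p := σ₂_smul _
  have e₄ : σ₂ • Y • X • X • p = X • X • Y • X • p := by rw [σ₂_smul, hβ']
  have e₅ : σ₂ • X • X • Y • X • p = X • p := by
    rw [σ₂_smul, xLift_smul_smul_smul, yLift_smul_Δ_zpow, yLift_smul_yLift, Δ_zpow_smul_Δ_zpow]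
    simp
  have : Fact (Nat.Prime 2) := ⟨Nat.prime_two⟩
  have : Fact (Nat.Prime 3) := ⟨Nat.prime_three⟩
  have w₂ := fun {q : S} (h : σ₂ ^ 2 • q = q) => hπ.weightOver_of_cycle (c := 1 / 3)
    (fun j => (weightMatrix_two_left j).ge) (fun j => (weightMatrix_two_right j).ge) h
  have w₃ := fun {q : S} (h : σ₂ ^ 3 • q = q) => hπ.weightOver_of_cycle
    le_weightMatrix_three_left le_weightMatrix_three_right h
  have c₁ := w₂ (q := X • Y • X • p)
    (by rw [pow_two, mul_smul, e₁, smul_Δ_zpow, e₂, Δ_zpow_smul_Δ_zpow]; simp)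
    (by
      rw [e₁]; intro e
      have := congrArg π e
      rw [hπ.map_Δ_zpow] at this
      tauto)
  have c₂ := w₂ (q := X • Y • X • X • p)
    (by rw [pow_two, mul_smul, e₂, smul_Δ_zpow, e₁, Δ_zpow_smul_Δ_zpow]; simp)
    (by
      rw [e₂]; intro e
      have := congrArg π e
      rw [hπ.map_Δ_zpow] at this
      tauto)
  have c₃ := w₃ (q := X • p) (by rw [pow_succ, pow_two, mul_smul, mul_smul, e₃, e₄, e₅])
    (by
      rw [e₃]; intro e
      have := congrArg π e
      tauto)
  have c₄ := w₃ (q := Y • X • X • p) (by rw [pow_succ, pow_two, mul_smul, mul_smul, e₄, e₅, e₃])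
    (by
      rw [e₄]; intro e
      have := congrArg π e
      tauto)
  rw [hα, hπ.map_Δ_zpow] at c₁
  rw [hβ'] at c₂
  rw [yLift_smul_yLift, hπ.map_Δ_zpow] at c₄
  linarith [c₁.1, c₁.2, c₂.1, c₂.2, c₃.1, c₃.2, c₄.1, c₄.2]

/-- Relative to the two vertices of the `y`-edge at its free site, a copy of `F₁` or `F₂` can be
filled by half a fiber less than its weight. -/
lemma exists_fill_fragment [Fintype S] [MulAction.IsPretransitive B3 S] (hπ : IsCovering π)
    (hN : 2 ≤ deltaOrder S) {w : V} (hw : IsFragmentOne w ∨ IsFragmentTwo w) :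
    ∃ P : Finset S,
      (P.card : ℚ) + deltaOrder S / 2 ≤ weightOver π {v | v ∈ fragmentVertices w} ∧
      ∀ Q : Set S, IsQuarantine Q → (∀ q, π q = w → q ∈ Q) → (∀ q, π q = y • w → q ∈ Q) →
        (P : Set S) ⊆ Q → ∀ q, π q ∈ fragmentVertices w → q ∈ Q := by
  classical
  obtain ⟨p, rfl⟩ := hπ.surjective w
  have hN' : (2 : ℚ) ≤ deltaOrder S := by exact_mod_cast hN
  have hpos : 0 < deltaOrder S := deltaOrder_pos
  simp only [← hπ.map_yLift, hπ.forall_fiber_iff]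
  have hunion : ∀ (a b : S) (k l : ℕ),
      ((deltaSegment a k ∪ deltaSegment b l).card : ℚ) ≤ k + l := by
    intro a b k l
    exact_mod_cast (Finset.card_union_le _ _).trans
      (add_le_add (card_deltaSegment_le a k) (card_deltaSegment_le b l))
  rcases hw with ⟨hnd, h₁, -⟩ | ⟨hnd, h₁, h₂⟩
  · simp only [← hπ.map_xLift, ← hπ.map_yLift] at h₁
    obtain ⟨α, hα⟩ := hπ.fiber _ _ h₁
    refine ⟨deltaSegment (X • p) (deltaOrder S) ∪ deltaSegment (X • Y • X • p) 1, ?_, ?_⟩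
    · have := hπ.weightOver_fragmentVertices_ge hnd
      have := hunion (X • p) (X • Y • X • p) (deltaOrder S) 1
      push_cast at this
      linarith
    · intro Q hQ h h' hP
      rw [Finset.coe_union, Set.union_subset_iff] at hP
      have hu := forall_zpow_of_deltaSegment hP.1
      obtain ⟨f₁, f₂, f₃, f₄, f₅⟩ := hQ.triangle_full h h' hu
      exact hπ.forall_fragmentVertices hu f₁ f₂ f₃ (hQ.fragmentOne f₂ f₄ f₃ f₅ hα
        (by simpa using deltaSegment_subset.1 hP.2 0 one_pos))
  · simp only [← hπ.map_xLift, ← hπ.map_yLift] at h₁ h₂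
    obtain ⟨α, hα⟩ := hπ.fiber _ _ h₁
    obtain ⟨β, hβ⟩ := hπ.fiber _ _ h₂
    by_cases hδ : (deltaOrder S : ℤ) ∣ 1 + β - α
    · rw [Δ_zpow_smul_congr (j := 1 + β) (by rw [dvd_sub_comm]; exact hδ)] at hα
      by_cases hε : (deltaOrder S : ℤ) ∣ β - 1
      · refine ⟨deltaSegment (X • p) (deltaOrder S) ∪
          deltaSegment (X • Y • X • p) (deltaOrder S), ?_, ?_⟩
        · have := hunion (X • p) (X • Y • X • p) (deltaOrder S) (deltaOrder S)
          have := hπ.weightOver_fragmentTwo_ge hnd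
            (by rw [hα]; exact Δ_zpow_smul_congr (by convert hε using 1; ring) _)
            (by rw [hβ]; exact Δ_zpow_smul_congr hε _)
          linarith
        · intro Q hQ h h' hP
          rw [Finset.coe_union, Set.union_subset_iff] at hP
          have hu := forall_zpow_of_deltaSegment hP.1
          obtain ⟨f₁, f₂, f₃, f₄, f₅⟩ := hQ.triangle_full h h' hu
          exact hπ.forall_fragmentVertices hu f₁ f₂ f₃ (hQ.fragmentTwo f₂ f₄ f₃ f₅ hα hβ
            fun i _ => forall_zpow_of_deltaSegment hP.2 i)
      · refine ⟨deltaSegment (X • Y • X • p) (deltaOrder S) ∪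
          deltaSegment (X • p) (Int.gcd (β - 1) (deltaOrder S)), ?_, ?_⟩
        · have := hunion (X • Y • X • p) (X • p) (deltaOrder S) (Int.gcd (β - 1) (deltaOrder S))
          have := hπ.weightOver_fragmentVertices_ge hnd
          have : (2 * Int.gcd (β - 1) (deltaOrder S) : ℚ) ≤ deltaOrder S := by
            exact_mod_cast two_mul_gcd_le hpos hε
          linarith
        · intro Q hQ h h' hP
          rw [Finset.coe_union, Set.union_subset_iff] at hP
          have hu := hQ.fragmentTwo' h h' hα hβ (forall_zpow_of_deltaSegment hP.1)
            (deltaSegment_subset.1 hP.2)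
          obtain ⟨f₁, f₂, f₃, f₄, f₅⟩ := hQ.triangle_full h h' hu
          exact hπ.forall_fragmentVertices hu f₁ f₂ f₃ (hQ.fragmentTwo f₂ f₄ f₃ f₅ hα hβ
            fun i _ => forall_zpow_of_deltaSegment hP.1 i)
    · refine ⟨deltaSegment (X • p) (deltaOrder S) ∪
        deltaSegment (X • Y • X • p) (Int.gcd (1 + β - α) (deltaOrder S)), ?_, ?_⟩
      · have := hunion (X • p) (X • Y • X • p) (deltaOrder S)
          (Int.gcd (1 + β - α) (deltaOrder S))
        have := hπ.weightOver_fragmentVertices_ge hnd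
        have : (2 * Int.gcd (1 + β - α) (deltaOrder S) : ℚ) ≤ deltaOrder S := by
          exact_mod_cast two_mul_gcd_le hpos hδ
        linarith
      · intro Q hQ h h' hP
        rw [Finset.coe_union, Set.union_subset_iff] at hP
        have hu := forall_zpow_of_deltaSegment hP.1
        obtain ⟨f₁, f₂, f₃, f₄, f₅⟩ := hQ.triangle_full h h' hu
        exact hπ.forall_fragmentVertices hu f₁ f₂ f₃ (hQ.fragmentTwo f₂ f₄ f₃ f₅ hα hβ
          (deltaSegment_subset.1 hP.2))

end IsCovering

end Fragments

/-! ### Filling sets of vertices -/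

section Fills

variable {S V : Type*} [MulAction B3 S] {π : S → V}

/-- `Fills π P U`: the set `P` is non-empty, and every quarantine that contains `P` contains all
points over `U`. -/
def Fills (π : S → V) (P : Finset S) (U : Set V) : Prop :=
  P.Nonempty ∧ ∀ Q : Set S, IsQuarantine Q → (P : Set S) ⊆ Q → ∀ q, π q ∈ U → q ∈ Q

open scoped Classical in
lemma Fills.union {P P' : Finset S} {U U' : Set V} (h : Fills π P U)
    (h' : ∀ Q : Set S, IsQuarantine Q → (∀ q, π q ∈ U → q ∈ Q) → (P' : Set S) ⊆ Q →
      ∀ q, π q ∈ U' → q ∈ Q) : Fills π (P ∪ P') (U ∪ U') := by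
  refine ⟨h.1.mono Finset.subset_union_left, fun Q hQ hP q hq => ?_⟩
  rw [Finset.coe_union, Set.union_subset_iff] at hP
  have hU := h.2 Q hQ hP.1
  exact hq.elim (hU q) (h' Q hQ hU hP.2 q)

lemma immunity_le_weight_of_fills [Fintype S] {P : Finset S} (h : Fills π P Set.univ)
    (hP : (P.card : ℚ) ≤ weightOver π Set.univ) : immunity S ≤ weight S := by
  classical
  refine div_le_div_of_nonneg_right ?_ (Nat.cast_nonneg _)
  have h₁ : sInf {n : ℕ | ∃ P : Set S, IsPlague P ∧ P.ncard = n} ≤ P.card := by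
    refine Nat.sInf_le ⟨P, ⟨h.1, fun Q hQ hPQ => ?_⟩, Set.ncard_coe_finset P⟩
    exact Set.eq_univ_of_forall fun q => h.2 Q hQ hPQ q (Set.mem_univ _)
  have h₂ : weightOver π Set.univ = ∑ p : S, pointWeight p := by simp [weightOver]
  rw [← h₂]
  exact le_trans (by exact_mod_cast h₁) hP

end Fills

/-! ### The cost of the graphs `H_k` -/

section Chain

variable {S V : Type*} [MulAction B3 S] [MulAction Modular V] {π : S → V}

lemma RobustChain.end_mem (hπ : IsCovering π) {v₀ : V} {k : ℕ} {H E : Set V}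
    (h : RobustChain v₀ k H E) : ∀ w ∈ E, w ∈ H ∧ y • w ∈ H := by
  induction h with
  | base _ _ =>
    rintro w rfl
    simp [hπ.y_smul_y_smul]
  | step _ _ _ _ ih =>
    rintro v (hv | hv)
    · exact ⟨Or.inl (ih v hv.1).1, Or.inl (ih v hv.1).2⟩
    · rcases hv with rfl | rfl <;> simp [hπ.y_smul_y_smul]

lemma RobustChain.end_nonempty {v₀ : V} {k : ℕ} {H E : Set V}
    (h : RobustChain v₀ k H E) : E.Nonempty := by
  cases h with
  | base _ _ => exact ⟨_, rfl⟩
  | step _ _ _ _ => exact ⟨_, Or.inr (Or.inl rfl)⟩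

lemma RobustChain.x_smul_root {v₀ : V} {k : ℕ} {H E : Set V}
    (h : RobustChain v₀ k H E) : x • v₀ = v₀ ∧ y • v₀ ≠ v₀ := by
  induction h with
  | base h h' => exact ⟨h, h'⟩
  | step _ _ _ _ ih => exact ih

/-- A quarantine that contains the fibers of `p`, `Y • p` and `X • p` contains the points over the
four vertices that a step of a chain adds at `π p`. -/
lemma IsCovering.forall_new_vertices (hπ : IsCovering π) {Q : Set S} (hQ : IsQuarantine Q) {p : S}
    (h : ∀ i : ℤ, Δ ^ i • p ∈ Q) (h' : ∀ i : ℤ, Δ ^ i • Y • p ∈ Q)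
    (hu : ∀ i : ℤ, Δ ^ i • X • p ∈ Q) (q : S)
    (hq : π q ∈ ({x • π p, x • x • π p, y • x • π p, y • x • x • π p} : Set V)) : q ∈ Q := by
  obtain ⟨f₁, f₂, f₃, -, -⟩ := hQ.triangle_full h h' hu
  simp only [← hπ.map_xLift, ← hπ.map_yLift] at hq
  rcases hq with hq | hq | hq | hq
  · exact (hπ.forall_fiber_iff _).2 hu q hq
  · exact (hπ.forall_fiber_iff _).2 f₁ q hq
  · exact (hπ.forall_fiber_iff _).2 f₂ q hq
  · exact (hπ.forall_fiber_iff _).2 f₃ q hq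

variable [Fintype S] [MulAction.IsPretransitive B3 S]

/-- The graph `H_k` can be filled by half a fiber more than its weight. This excess is avoided
when an end vertex of a proper `H_k` carries an `x`-loop: the triangle next to this loop costs only
two points instead of a whole fiber. -/
lemma RobustChain.exists_fills (hπ : IsCovering π) (hN : 2 ≤ deltaOrder S) {v₀ : V} {k : ℕ}
    {H E : Set V} (hc : RobustChain v₀ k H E) :
    (∃ P, Fills π P H ∧ (P.card : ℚ) ≤ weightOver π H + deltaOrder S / 2) ∧
      (k ≠ 0 → ∀ e ∈ E, x • e = e → ∃ P, Fills π P H ∧ (P.card : ℚ) ≤ weightOver π H) := by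
  classical
  induction hc with
  | base hx hy =>
    refine ⟨?_, fun h => absurd rfl h⟩
    obtain ⟨p, rfl⟩ := hπ.surjective v₀
    rw [← hπ.map_xLift] at hx
    obtain ⟨m, hm⟩ := hπ.fiber _ _ hx
    refine ⟨deltaSegment p (deltaOrder S), ⟨?_, ?_⟩, ?_⟩
    · exact ⟨_, Finset.mem_image_of_mem _ (Finset.mem_range.2 (by omega : 0 < deltaOrder S))⟩
    · intro Q hQ hP
      have h := forall_zpow_of_deltaSegment hP
      have h' : ∀ i : ℤ, Δ ^ i • Y • p ∈ Q := by
        intro i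
        have t := (hQ.triple (Δ ^ (i - m - m) • p)).1
        simp only [xLift_smul_Δ_zpow, yLift_smul_Δ_zpow, hm, Δ_zpow_smul_Δ_zpow] at t
        simpa using t (h _) (h _)
      rintro q (hq | hq)
      · exact (hπ.forall_fiber_iff _).2 h q hq
      · rw [← hπ.map_yLift] at hq
        exact (hπ.forall_fiber_iff _).2 h' q hq
    · have h₁ : ((deltaSegment p (deltaOrder S)).card : ℚ) ≤ deltaOrder S := by
        exact_mod_cast card_deltaSegment_le p _
      rw [Set.insert_eq, weightOver_union (by simpa using hy.symm)]
      linarith [hπ.weightOver_singleton_ge (π p), hπ.weightOver_singleton_ge (y • π p)]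
  | @step k H E w hc hw hnd hnew ih =>
    obtain ⟨⟨P, hP, hPc⟩, ihE⟩ := ih
    obtain ⟨hwH, hywH⟩ := hc.end_mem hπ w hw
    set W : Set V := {x • w, x • x • w, y • x • w, y • x • x • w} with hW
    have hWl : W = {v | v ∈ [x • w, x • x • w, y • x • w, y • x • x • w]} := by
      ext v; simp [hW]
    have hdisj : Disjoint H W := by
      rw [Set.disjoint_right, hWl]; exact hnew
    have hsum : (deltaOrder S : ℚ) ≤ weightOver π W := by
      rw [hWl, weightOver_list hnd]
      simp only [List.map_cons, List.map_nil, List.sum_cons, List.sum_nil]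
      linarith [hπ.weightOver_singleton_ge (x • w), hπ.weightOver_singleton_ge (x • x • w),
        hπ.weightOver_singleton_ge (y • x • w), hπ.weightOver_singleton_ge (y • x • x • w)]
    rw [weightOver_union hdisj]
    obtain ⟨p, rfl⟩ := hπ.surjective w
    rw [← hπ.map_yLift] at hywH
    have full : ∀ {Q : Set S}, (∀ q, π q ∈ H → q ∈ Q) →
        (∀ i : ℤ, Δ ^ i • p ∈ Q) ∧ ∀ i : ℤ, Δ ^ i • Y • p ∈ Q := fun {Q} hQ =>
      ⟨fun i => hQ _ (by rwa [hπ.map_Δ_zpow]), fun i => hQ _ (by rwa [hπ.map_Δ_zpow])⟩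
    have generic : ∀ P₀ : Finset S, Fills π P₀ H →
        Fills π (P₀ ∪ deltaSegment (X • p) (deltaOrder S)) (H ∪ W) ∧
        ((P₀ ∪ deltaSegment (X • p) (deltaOrder S)).card : ℚ) ≤ P₀.card + deltaOrder S := by
      intro P₀ hP₀
      refine ⟨hP₀.union fun Q hQ hH hseg => ?_, ?_⟩
      · exact hπ.forall_new_vertices hQ (full hH).1 (full hH).2 (forall_zpow_of_deltaSegment hseg)
      · exact_mod_cast (Finset.card_union_le _ _).trans
          (add_le_add_right (card_deltaSegment_le (X • p) _) _)
    refine ⟨?_, fun _ e he hxe => ?_⟩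
    · obtain ⟨h₁, h₂⟩ := generic P hP
      exact ⟨_, h₁, by linarith⟩
    · rcases he with he | he
      · have hk : k ≠ 0 := by
          rintro rfl
          cases hc with
          | base _ _ => exact he.2 (he.1.trans hw.symm)
        obtain ⟨P₀, hP₀, hP₀c⟩ := ihE hk e he.1 hxe
        obtain ⟨h₁, h₂⟩ := generic P₀ hP₀
        exact ⟨_, h₁, by linarith⟩
      · obtain ⟨r, hr, hre⟩ : ∃ r : S, π r = e ∧ (r = Y • X • p ∨ r = Y • X • X • p) := by
          simp only [← hπ.map_xLift, ← hπ.map_yLift] at he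
          rcases he with he | he
          · exact ⟨_, he.symm, Or.inl rfl⟩
          · exact ⟨_, Eq.symm he, Or.inr rfl⟩
        subst hr
        rw [← hπ.map_xLift] at hxe
        obtain ⟨m, hm⟩ := hπ.fiber _ _ hxe
        have hd := dvd_of_xLift_smul hm
        have h3 : deltaOrder S ≠ 3 := by
          intro h
          rw [h] at hd
          omega
        -- One point suffices if `Δ` has order two, and two points are at most half a fiber
        -- otherwise, because the order is not three.
        obtain ⟨P', hP', hr', hm'⟩ : ∃ P' : Finset S, 2 * P'.card ≤ deltaOrder S ∧ r ∈ P' ∧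
            (deltaOrder S = 2 ∨ Δ ^ m • r ∈ P') := by
          by_cases h2 : deltaOrder S = 2
          · exact ⟨{r}, by simp [h2], by simp, Or.inl h2⟩
          · refine ⟨{r, Δ ^ m • r}, ?_, by simp, Or.inr (by simp)⟩
            have := Finset.card_le_two (a := r) (b := Δ ^ m • r)
            omega
        refine ⟨P ∪ P', hP.union fun Q hQ hH hPQ => ?_, ?_⟩
        · exact hπ.forall_new_vertices hQ (full hH).1 (full hH).2
            (hQ.triangle_of_loop (full hH).1 (full hH).2 hre hm (hPQ hr')
              (hm'.imp_right fun h => hPQ h))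
        · have h₁ : ((P ∪ P').card : ℚ) ≤ P.card + P'.card := by
            exact_mod_cast Finset.card_union_le _ _
          have h₂ : (2 * P'.card : ℚ) ≤ deltaOrder S := by exact_mod_cast hP'
          linarith

end Chain

/-! ### Gluing the fragments -/

section Main

variable {S V : Type*} [MulAction B3 S] [MulAction Modular V] {π : S → V}

/-- Each glued fragment saves half a fiber compared with its weight, and a single one of them makes
up for the excess of half a fiber in `H_k`. -/
lemma exists_fills_union_fragments [Fintype S] [MulAction.IsPretransitive B3 S]
    (hπ : IsCovering π) (hN : 2 ≤ deltaOrder S) {H : Set V} {P : Finset S} (hP : Fills π P H)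
    (hPc : (P.card : ℚ) ≤ weightOver π H + deltaOrder S / 2) (F : Finset V)
    (hF : ∀ w ∈ F, (w ∈ H ∧ y • w ∈ H) ∧ (IsFragmentOne w ∨ IsFragmentTwo w) ∧
      ∀ v ∈ fragmentVertices w, v ∉ H)
    (hdisj : ∀ w ∈ F, ∀ w' ∈ F, w ≠ w' → ∀ v ∈ fragmentVertices w, v ∉ fragmentVertices w') :
    ∃ P, Fills π P (H ∪ {v | ∃ w ∈ F, v ∈ fragmentVertices w}) ∧
      (P.card : ℚ) + F.card * (deltaOrder S / 2) ≤
        weightOver π (H ∪ {v | ∃ w ∈ F, v ∈ fragmentVertices w}) + deltaOrder S / 2 := by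
  classical
  induction F using Finset.induction_on with
  | empty => exact ⟨P, by simpa using hP, by simpa using hPc⟩
  | insert w F hw ih =>
    obtain ⟨P₁, hP₁, hc₁⟩ := ih (fun v hv => hF v (Finset.mem_insert_of_mem hv))
      (fun v hv v' hv' => hdisj v (Finset.mem_insert_of_mem hv) v' (Finset.mem_insert_of_mem hv'))
    obtain ⟨⟨hwH, hywH⟩, hfrag, hfH⟩ := hF w (Finset.mem_insert_self w F)
    obtain ⟨P₂, hc₂, hP₂⟩ := hπ.exists_fill_fragment hN hfrag
    have hset : H ∪ {v | ∃ w' ∈ insert w F, v ∈ fragmentVertices w'} =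
        (H ∪ {v | ∃ w' ∈ F, v ∈ fragmentVertices w'}) ∪ {v | v ∈ fragmentVertices w} := by
      ext v
      simp only [Set.mem_union, Set.mem_ofPred_eq, Finset.mem_insert, exists_eq_or_imp]
      rw [or_assoc, or_comm (a := v ∈ fragmentVertices w)]
    have hd : Disjoint (H ∪ {v | ∃ w' ∈ F, v ∈ fragmentVertices w'})
        {v | v ∈ fragmentVertices w} := by
      rw [Set.disjoint_right]
      rintro v hv (hvH | ⟨w', hw', hv'⟩)
      · exact hfH v hv hvH
      · exact hdisj w (Finset.mem_insert_self w F) w' (Finset.mem_insert_of_mem hw')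
          (by rintro rfl; exact hw hw') v hv hv'
    rw [hset, weightOver_union hd, Finset.card_insert_of_notMem hw]
    refine ⟨P₁ ∪ P₂, hP₁.union fun Q hQ hU hPQ => ?_, ?_⟩
    · exact hP₂ Q hQ (fun q hq => hU q (Or.inl (hq ▸ hwH))) (fun q hq => hU q (Or.inl (hq ▸ hywH)))
        hPQ
    · have h₁ : ((P₁ ∪ P₂).card : ℚ) ≤ P₁.card + P₂.card := by
        exact_mod_cast Finset.card_union_le _ _
      push_cast
      linarith

end Main

end HurwitzOrbit

theorem lemma5p4 {S V : Type*} [MulAction HurwitzOrbit.B3 S]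
    [MulAction.IsPretransitive HurwitzOrbit.B3 S] [Fintype S]
    [MulAction HurwitzOrbit.Modular V] (v₀ : V) (k : ℕ)
    (hG : HurwitzOrbit.IsSpan v₀ k) (π : S → V) (hπ : HurwitzOrbit.IsCovering π)
    (hS : HurwitzOrbit.SimplyIntersectingCycles S) :
    HurwitzOrbit.immunity S ≤ HurwitzOrbit.weight S := by
  classical
  obtain ⟨H, E, hc, hfrag, hfH, hff, hall⟩ := hG
  obtain ⟨hx, hy⟩ := hc.x_smul_root
  obtain ⟨p, hp⟩ := hπ.surjective v₀
  obtain ⟨m, hm⟩ := hπ.fiber (HurwitzOrbit.xLift • p) p (by rw [hπ.map_xLift, hp, hx])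
  have hyp : HurwitzOrbit.yLift • p ≠ p := by
    intro h
    apply hy
    rw [← hp, ← hπ.map_yLift, h]
  have hN : 2 ≤ HurwitzOrbit.deltaOrder S := by
    have h₁ := HurwitzOrbit.deltaOrder_ne_one hS hm hyp
    have h₂ := HurwitzOrbit.deltaOrder_pos (S := S)
    omega
  have : Finite V := Finite.of_surjective π hπ.surjective
  obtain ⟨⟨P, hP, hPc⟩, hloop⟩ := hc.exists_fills hπ hN
  by_cases hE : ∃ w ∈ E, HurwitzOrbit.x • w ≠ w
  · obtain ⟨w, hw, hxw⟩ := hE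
    have hF : ∀ v, v ∈ (Set.toFinite {v | v ∈ E ∧ HurwitzOrbit.x • v ≠ v}).toFinset ↔
        v ∈ E ∧ HurwitzOrbit.x • v ≠ v := by simp
    set F := (Set.toFinite {v | v ∈ E ∧ HurwitzOrbit.x • v ≠ v}).toFinset
    obtain ⟨P', hP', hPc'⟩ := HurwitzOrbit.exists_fills_union_fragments hπ hN hP hPc F
      (fun v hv => by
        rw [hF] at hv
        exact ⟨hc.end_mem hπ v hv.1, hfrag v hv.1 hv.2, hfH v hv.1 hv.2⟩)
      (fun v hv v' hv' => by
        rw [hF] at hv hv'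
        exact hff v hv.1 v' hv'.1 hv.2 hv'.2)
    have huniv : H ∪ {v | ∃ w ∈ F, v ∈ HurwitzOrbit.fragmentVertices w} = Set.univ := by
      refine Set.eq_univ_of_forall fun v => (hall v).imp_right ?_
      rintro ⟨w', hw', hxw', hv⟩
      exact ⟨w', (hF w').2 ⟨hw', hxw'⟩, hv⟩
    rw [huniv] at hP' hPc'
    refine HurwitzOrbit.immunity_le_weight_of_fills hP' ?_
    have hcard : (1 : ℚ) ≤ F.card := by
      exact_mod_cast Finset.card_pos.2 ⟨w, (hF w).2 ⟨hw, hxw⟩⟩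
    nlinarith [(Nat.cast_nonneg (HurwitzOrbit.deltaOrder S) : (0 : ℚ) ≤ _)]
  · push Not at hE
    have huniv : H = Set.univ := by
      refine Set.eq_univ_of_forall fun v => (hall v).resolve_right ?_
      rintro ⟨w', hw', hxw', -⟩
      exact hxw' (hE w' hw')
    obtain ⟨e, he⟩ := hc.end_nonempty
    have hk : k ≠ 0 := by
      rintro rfl
      cases hc with
      | base _ _ =>
        have hxy := hE _ he
        rw [Set.mem_singleton_iff] at he
        rw [he, ← hp, ← hπ.map_yLift, ← hπ.map_xLift] at hxy
        obtain ⟨n, hn⟩ := hπ.fiber _ _ hxy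
        exact HurwitzOrbit.not_both_loops hS hm hn hyp
    obtain ⟨P', hP', hPc'⟩ := hloop hk e he (hE e he)
    rw [huniv] at hP' hPc'
    exact HurwitzOrbit.immunity_le_weight_of_fills hP' hPc'
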